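/- Let $m\ge 3$ and let $G$ be a group of type $\mathcal{D}_2$, i.e. a group isomorphic to $$\langle x,y,t \mid t^{2^m}=1,\ x^2=y^2=t,\ t \text{ central},\ (x,y)=t^{2^{m-1}}\rangle ,$$ where $(x,y)$ denotes the commutator of $x$ and $y$. (1) The rational group algebra $\mathbb{Q}G$ is isomorphic, as a $\mathbb{Q}$-algebra, to the direct sum of $2m+2$ fields and one quaternion algebra over a field. (A quaternion algebra over a field $E$ of characteristic different from $2$ is an algebra with $E$-basis $1,i,j,ij$ and $i^2=a$, $j^2=b$, $ij=-ji$ for some nonzero $a,b\in E$; it may be split.) (2) Let $K$ be a finite field of odd order $q$. Then $KG$ is semisimple, and its Wedderburn decomposition has at least $4m$ simple components. If $q\equiv 3\pmod 8$, this lower bound is attained: $KG$ has exactly $4m$ simple components, and it is isomorphic, as a $K$-algebra, to the direct sum of $4m-2$ fields and two quaternion algebras over fields, each of which is isomorphic to the ring of $2\times 2$ matrices over its centre. -/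

import Mathlib

open scoped Quaternion

universe u v

/-- The three generators of the presentation of a group of type `D₂`. -/
inductive D2Gen : Type
  | x
  | y
  | t

/-- The relators of the group
`⟨x, y, t ∣ t^(2^m) = 1, x² = y² = t, t central, (x, y) = t^(2^(m-1))⟩`,
where `(x, y) = x⁻¹y⁻¹xy`. -/
def D2Rels (m : ℕ) : Set (FreeGroup D2Gen) :=
  let x := FreeGroup.of D2Gen.x
  let y := FreeGroup.of D2Gen.y
  let t := FreeGroup.of D2Gen.t
  {t ^ 2 ^ m, x ^ 2 * t⁻¹, y ^ 2 * t⁻¹,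
    t⁻¹ * x⁻¹ * t * x, t⁻¹ * y⁻¹ * t * y,
    x⁻¹ * y⁻¹ * x * y * (t ^ 2 ^ (m - 1))⁻¹}

/-- `G` is a group of type `D₂` with parameter `m`. -/
def IsTypeD2 (m : ℕ) (G : Type*) [Group G] : Prop :=
  Nonempty (G ≃* PresentedGroup (D2Rels m))

/-- The number of simple components in the Wedderburn decomposition of a semisimple ring `R`.
The components are the minimal nonzero two-sided ideals of `R`. -/
noncomputable def numSimpleComponents (R : Type*) [Ring R] : ℕ :=
  Set.ncard {I : TwoSidedIdeal R | IsAtom I}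

/-!
Let `z = t ^ 2 ^ (m - 1)` be the commutator of `x` and `y`, a central involution. When `2` is
invertible in the field `K`, the central idempotents `(1 ± z) / 2` split the group algebra in two.

* The part with `z = 1` is commutative, with `y ^ 2 = x ^ 2` and `x ^ 2 ^ m = 1`. The idempotents
  `(1 ± x⁻¹ y) / 2` split it into two copies of `K[X]/(X ^ 2 ^ m - 1)`.
* In the part with `z = -1` the elements `x` and `y` anticommute and have the common square `t`,
  which satisfies `t ^ 2 ^ (m - 1) = -1`. This is the quaternion algebra with both parameters `t`
  over `K[t]/(t ^ 2 ^ (m - 1) + 1)`.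

Every factorization of the two polynomials into coprime factors refines this decomposition. The map
from the group algebra to the product of the resulting components is shown to be surjective
(`D2.surjective_components`). It is injective because the product has dimension `2 ^ (m + 2)`
(`D2.finrank_components`), while every element of the group has the form `x ^ i` or `x ^ i * y`, so
that there are at most `2 ^ (m + 2)` of them (`D2.card_le`). This gives
`D2.nonempty_algEquiv_components`; semisimplicity is Maschke's theorem.

Since `X ^ 2 ^ m - 1 = (X - 1) (X + 1) (X ^ 2 + 1) ⋯ (X ^ 2 ^ (m - 1) + 1)`, it remains to factor
the polynomials `X ^ 2 ^ k + 1`. Over `ℚ` they are cyclotomic, hence irreducible. Over a finite field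
and for `k ≥ 2` each has two factors of equal degree, because one of `-1`, `2`, `-2` is a square
(`exists_mul_eq_X_pow_add_one_of_natDegree_eq`). If `q ≡ 3` modulo `8`, the order of `q` modulo
`2 ^ (k + 1)` is `2 ^ (k - 1)`, so that these two factors are irreducible
(`irreducible_of_dvd_X_pow_two_pow_add_one`). The quaternion algebras are then split because their
centres contain a square root of `-1`.

A finite ring that is a product of nonzero rings has at least as many minimal two-sided ideals as
factors; a finite product of simple rings has at most that many
(`card_le_numSimpleComponents`, `numSimpleComponents_le`).
-/

namespace D2

/-! ### The presented group -/

section Group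

variable {m : ℕ}

/-- The generator `x` of the presented group. -/
def x (m : ℕ) : PresentedGroup (D2Rels m) := .of .x

/-- The generator `y` of the presented group. -/
def y (m : ℕ) : PresentedGroup (D2Rels m) := .of .y

/-- The generator `t` of the presented group. -/
def t (m : ℕ) : PresentedGroup (D2Rels m) := .of .t

theorem t_pow : t m ^ 2 ^ m = 1 :=
  PresentedGroup.one_of_mem (rels := D2Rels m) (by simp [D2Rels])

theorem x_sq : x m ^ 2 = t m :=
  mul_inv_eq_one.1 (PresentedGroup.one_of_mem (rels := D2Rels m)
    (x := FreeGroup.of D2Gen.x ^ 2 * (FreeGroup.of D2Gen.t)⁻¹) (by simp [D2Rels]))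

theorem y_sq : y m ^ 2 = t m :=
  mul_inv_eq_one.1 (PresentedGroup.one_of_mem (rels := D2Rels m)
    (x := FreeGroup.of D2Gen.y ^ 2 * (FreeGroup.of D2Gen.t)⁻¹) (by simp [D2Rels]))

theorem commutator_eq : (x m)⁻¹ * (y m)⁻¹ * x m * y m = t m ^ 2 ^ (m - 1) :=
  mul_inv_eq_one.1 (PresentedGroup.one_of_mem (rels := D2Rels m)
    (x := (FreeGroup.of D2Gen.x)⁻¹ * (FreeGroup.of D2Gen.y)⁻¹ * FreeGroup.of D2Gen.x *
      FreeGroup.of D2Gen.y * (FreeGroup.of D2Gen.t ^ 2 ^ (m - 1))⁻¹) (by simp [D2Rels]))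

/-- Conjugation by `y` maps `x` to a power of `x`, because the commutator of `x` and `y` is a
power of `x² = t = y²`. -/
theorem semiconjBy_y_x : SemiconjBy (y m) (x m) (x m ^ (1 - 2 * 2 ^ (m - 1) : ℤ)) := by
  have h := commutator_eq (m := m)
  have hz : t m ^ 2 ^ (m - 1) = x m ^ (2 * 2 ^ (m - 1) : ℤ) := by
    rw [← x_sq, ← pow_mul, ← zpow_natCast]; push_cast; rfl
  have hc : Commute (t m ^ 2 ^ (m - 1)) (y m) := by
    rw [← y_sq, ← pow_mul]; exact (Commute.refl _).pow_left _
  have hxy : x m * y m = y m * x m * t m ^ 2 ^ (m - 1) := by rw [← h]; group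
  rw [SemiconjBy, zpow_sub, zpow_one, ← hz, mul_assoc, hc.inv_left.eq, ← mul_assoc, hxy]
  group

/-- The subgroup generated by `x` has index at most two. -/
theorem exists_eq_zpow_or (g : PresentedGroup (D2Rels m)) :
    ∃ i : ℤ, g = x m ^ i ∨ g = x m ^ i * y m := by
  have hy (i : ℤ) : y m * x m ^ i = x m ^ ((1 - 2 * 2 ^ (m - 1)) * i) * y m := by
    rw [zpow_mul]; exact semiconjBy_y_x.zpow_right i
  have hyy : y m * y m = x m ^ (2 : ℤ) := by
    rw [← sq, y_sq, ← x_sq]; rfl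
  have hmulx (n : ℤ) (g) (h : ∃ i : ℤ, g = x m ^ i ∨ g = x m ^ i * y m) :
      ∃ i : ℤ, x m ^ n * g = x m ^ i ∨ x m ^ n * g = x m ^ i * y m := by
    obtain ⟨i, rfl | rfl⟩ := h
    · exact ⟨n + i, .inl (zpow_add _ _ _).symm⟩
    · exact ⟨n + i, .inr (by rw [zpow_add, mul_assoc])⟩
  have hmuly (g) (h : ∃ i : ℤ, g = x m ^ i ∨ g = x m ^ i * y m) :
      ∃ i : ℤ, y m * g = x m ^ i ∨ y m * g = x m ^ i * y m := by
    obtain ⟨i, rfl | rfl⟩ := h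
    · exact ⟨_, .inr (hy i)⟩
    · exact ⟨(1 - 2 * 2 ^ (m - 1)) * i + 2, .inl (by
        rw [← mul_assoc, hy, mul_assoc, hyy, zpow_add])⟩
  have hyinv : (y m)⁻¹ = x m ^ (-2 : ℤ) * y m := by
    rw [zpow_neg, ← hyy]; group
  have hmem : g ∈ Subgroup.closure (Set.range (PresentedGroup.of (rels := D2Rels m))) := by simp
  induction hmem using Subgroup.closure_induction_left with
  | one => exact ⟨0, .inl (by simp)⟩
  | mul_left a ha g _ h =>
    obtain ⟨_ | _ | _, rfl⟩ := ha
    · have := hmulx 1 g h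
      rw [zpow_one] at this
      exact this
    · exact hmuly g h
    · have := hmulx 2 g h
      rwa [show x m ^ (2 : ℤ) = t m from x_sq] at this
  | inv_mul_cancel a ha g _ h =>
    obtain ⟨_ | _ | _, rfl⟩ := ha
    · have := hmulx (-1) g h
      rw [zpow_neg_one] at this
      exact this
    · have := hmulx (-2) _ (hmuly g h)
      rwa [← mul_assoc, ← hyinv] at this
    · have := hmulx (-2) g h
      rwa [zpow_neg, show x m ^ (2 : ℤ) = t m from x_sq] at this

theorem x_pow : x m ^ (2 * 2 ^ m) = 1 := by rw [pow_mul, x_sq, t_pow]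

theorem exists_fin_surjective :
    ∃ f : Fin (2 * 2 ^ m) × Bool → PresentedGroup (D2Rels m), Function.Surjective f := by
  refine ⟨fun a => x m ^ (a.1 : ℕ) * if a.2 then y m else 1, fun g => ?_⟩
  have hpos : (0 : ℤ) < 2 * 2 ^ m := by positivity
  have key (i : ℤ) : ∃ n : Fin (2 * 2 ^ m), x m ^ i = x m ^ (n : ℕ) := by
    have h0 := Int.emod_nonneg i hpos.ne'
    have h1 := Int.emod_lt_of_pos i hpos
    refine ⟨⟨(i % (2 * 2 ^ m)).toNat, by zify; rw [Int.toNat_of_nonneg h0]; exact h1⟩, ?_⟩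
    rw [← zpow_natCast, Int.toNat_of_nonneg h0]
    conv_lhs => rw [← Int.emod_add_mul_ediv i (2 * 2 ^ m), zpow_add, zpow_mul]
    have : x m ^ (2 * 2 ^ m : ℤ) = 1 := by exact_mod_cast x_pow (m := m)
    rw [this, one_zpow, mul_one]
  obtain ⟨i, rfl | rfl⟩ := exists_eq_zpow_or g <;> obtain ⟨n, hn⟩ := key i
  · exact ⟨(n, false), by simp [hn]⟩
  · exact ⟨(n, true), by simp [hn]⟩

instance : Finite (PresentedGroup (D2Rels m)) :=
  let ⟨_, h⟩ := exists_fin_surjective (m := m)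
  Finite.of_surjective _ h

theorem card_le : Nat.card (PresentedGroup (D2Rels m)) ≤ 4 * 2 ^ m := by
  obtain ⟨_, h⟩ := exists_fin_surjective (m := m)
  refine (Nat.card_le_card_of_surjective _ h).trans_eq ?_
  simp; ring

variable {B : Type*} [Monoid B]

/-- The universal property of the presented group, for homomorphisms into a monoid. The conditions
force the images of the generators to be invertible. -/
theorem exists_hom (a b : B) (hab : a ^ 2 = b ^ 2) (ha : (a ^ 2) ^ 2 ^ m = 1)
    (hcomm : a * b = b * a * (a ^ 2) ^ 2 ^ (m - 1)) :
    ∃ f : PresentedGroup (D2Rels m) →* B, f (x m) = a ∧ f (y m) = b := by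
  let a' : Bˣ := Units.ofPowEqOne a (2 * 2 ^ m) (by rw [pow_mul, ha]) (by positivity)
  let b' : Bˣ := Units.ofPowEqOne b (2 * 2 ^ m) (by rw [pow_mul, ← hab, ha]) (by positivity)
  have hab' : a' ^ 2 = b' ^ 2 := Units.ext hab
  have ha' : (a' ^ 2) ^ 2 ^ m = 1 := Units.ext ha
  have hcomm' : a' * b' = b' * a' * (a' ^ 2) ^ 2 ^ (m - 1) := Units.ext hcomm
  let s : D2Gen → Bˣ := fun g => match g with
    | .x => a'
    | .y => b'
    | .t => a' ^ 2
  have hs : ∀ r ∈ D2Rels m, FreeGroup.lift s r = 1 := by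
    intro r hr
    simp only [D2Rels, Set.mem_insert_iff, Set.mem_singleton_iff] at hr
    rcases hr with rfl | rfl | rfl | rfl | rfl | rfl <;>
      simp only [map_mul, map_pow, map_inv, FreeGroup.lift_apply_of, s]
    · exact ha'
    · group
    · rw [hab']; group
    · group
    · rw [hab']; group
    · rw [mul_assoc (a'⁻¹ * b'⁻¹), hcomm']; group
  refine ⟨(Units.coeHom B).comp (PresentedGroup.toGroup hs), ?_, ?_⟩
  · simp [x, s, a']
  · simp [y, s, b']

end Group
end D2

/-! ### The group algebra as a product -/

open Polynomial

/-- The Chinese remainder theorem for polynomials. -/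
theorem AdjoinRoot.exists_forall_mk_eq {K ι : Type*} [Field K] [Finite ι] {p : ι → K[X]}
    (hp : Pairwise fun i j => IsCoprime (p i) (p j)) (a : ∀ i, AdjoinRoot (p i)) :
    ∃ P : K[X], ∀ i, AdjoinRoot.mk (p i) P = a i :=
  Ideal.pi_quotient_surjective (I := fun i => Ideal.span {p i})
    (fun _ _ hij => (Ideal.isCoprime_span_singleton_iff _ _).2 (hp hij)) a

theorem Polynomial.Separable.pairwise_isCoprime_of_prod {K ι : Type*} [Field K] [Fintype ι]
    {p : ι → K[X]} (hp : (∏ i, p i).Separable) : Pairwise fun i j => IsCoprime (p i) (p j) := by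
  classical
  intro i j hij
  rw [← Finset.mul_prod_erase _ _ (Finset.mem_univ i), ← Finset.mul_prod_erase _ _
    (Finset.mem_erase.2 ⟨hij.symm, Finset.mem_univ j⟩), ← mul_assoc] at hp
  exact hp.of_mul_left.isCoprime

theorem AdjoinRoot.root_pow_eq_one {K : Type*} [Field K] {p : K[X]} {n : ℕ}
    (h : p ∣ X ^ n - 1) : AdjoinRoot.root p ^ n = 1 := by
  have := AdjoinRoot.mk_eq_zero.2 h
  rwa [map_sub, map_pow, map_one, AdjoinRoot.mk_X, sub_eq_zero] at this

theorem AdjoinRoot.root_pow_eq_neg_one {K : Type*} [Field K] {p : K[X]} {n : ℕ}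
    (h : p ∣ X ^ n + 1) : AdjoinRoot.root p ^ n = -1 := by
  have := AdjoinRoot.mk_eq_zero.2 h
  rwa [map_add, map_pow, map_one, AdjoinRoot.mk_X, add_eq_zero_iff_eq_neg] at this

namespace D2

variable {K ι κ : Type*} [Field K] [Fintype ι] [Fintype κ] {m : ℕ} (p : ι → K[X]) (r : κ → K[X])

/-- The product of the components of the group algebra: two copies of `K[X]/(p i)` for each `i`,
and a quaternion algebra over each `K[X]/(r j)`, both of whose parameters are the root. -/
abbrev Components : Type _ :=
  (∀ k : ι × Bool, AdjoinRoot (p k.1)) ×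
    (∀ j, ℍ[AdjoinRoot (r j), AdjoinRoot.root (r j), AdjoinRoot.root (r j)])

theorem quaternion_coe_pow {R : Type*} [CommRing R] {c₁ c₂ : R} (a : R) (n : ℕ) :
    ((a : ℍ[R, c₁, c₂]) ^ n) = ((a ^ n : R) : ℍ[R, c₁, c₂]) :=
  (map_pow (algebraMap R ℍ[R, c₁, c₂]) a n).symm

theorem quaternion_i_sq {R : Type*} [CommRing R] (c₁ c₂ : R) :
    (⟨0, 1, 0, 0⟩ : ℍ[R, c₁, c₂]) ^ 2 = (c₁ : ℍ[R, c₁, c₂]) := by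
  rw [sq]; ext <;> simp

theorem quaternion_j_sq {R : Type*} [CommRing R] (c₁ c₂ : R) :
    (⟨0, 0, 1, 0⟩ : ℍ[R, c₁, c₂]) ^ 2 = (c₂ : ℍ[R, c₁, c₂]) := by
  rw [sq]; ext <;> simp

variable {p r}

/-- The homomorphism from the group algebra to a commutative component. -/
theorem exists_algHom_adjoinRoot (hm : 1 ≤ m) {q : K[X]} (hq : q ∣ X ^ 2 ^ m - 1) (b : Bool) :
    ∃ f : MonoidAlgebra K (PresentedGroup (D2Rels m)) →ₐ[K] AdjoinRoot q,
      f (.of K _ (x m)) = .root q ∧ f (.of K _ (y m)) = (if b then 1 else -1) * .root q := by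
  have h1 : AdjoinRoot.root q ^ 2 ^ m = 1 := AdjoinRoot.root_pow_eq_one hq
  have h2 : (AdjoinRoot.root q ^ 2) ^ 2 ^ (m - 1) = 1 := by
    rw [← pow_mul, ← pow_succ', Nat.sub_add_cancel hm, h1]
  obtain ⟨f, hx, hy⟩ := exists_hom (m := m) (AdjoinRoot.root q) ((if b then 1 else -1) * .root q)
    (by cases b <;> simp) (by rw [← pow_mul, mul_comm, pow_mul, h1, one_pow])
    (by rw [h2, mul_one, mul_comm])
  exact ⟨MonoidAlgebra.lift K _ _ f, by simp [hx], by simp [hy]⟩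

/-- The homomorphism from the group algebra to a quaternion component. -/
theorem exists_algHom_quaternion (hm : 1 ≤ m) {q : K[X]} (hq : q ∣ X ^ 2 ^ (m - 1) + 1) :
    ∃ f : MonoidAlgebra K (PresentedGroup (D2Rels m)) →ₐ[K]
        ℍ[AdjoinRoot q, AdjoinRoot.root q, AdjoinRoot.root q],
      f (.of K _ (x m)) = ⟨0, 1, 0, 0⟩ ∧ f (.of K _ (y m)) = ⟨0, 0, 1, 0⟩ := by
  have h1 : AdjoinRoot.root q ^ 2 ^ (m - 1) = -1 := AdjoinRoot.root_pow_eq_neg_one hq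
  have h2 : AdjoinRoot.root q ^ 2 ^ m = 1 := by
    rw [← Nat.sub_add_cancel hm, pow_succ, pow_mul, h1]; ring
  obtain ⟨f, hx, hy⟩ := exists_hom (m := m)
    (⟨0, 1, 0, 0⟩ : ℍ[AdjoinRoot q, AdjoinRoot.root q, AdjoinRoot.root q]) ⟨0, 0, 1, 0⟩
    (by rw [quaternion_i_sq, quaternion_j_sq])
    (by rw [quaternion_i_sq, quaternion_coe_pow, h2]; rfl)
    (by rw [quaternion_i_sq, quaternion_coe_pow, h1]; ext <;> simp)
  exact ⟨MonoidAlgebra.lift K _ _ f, by simp [hx], by simp [hy]⟩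

theorem inv_two_smul_one_add_one (h2 : (2 : K) ≠ 0) {B : Type*} [Ring B] [Algebra K B] :
    (2⁻¹ : K) • (1 + 1 : B) = 1 := by
  rw [← two_smul K (1 : B), smul_smul, inv_mul_cancel₀ h2, one_smul]

/-- A homomorphism to the product of the components that maps two elements to the images of `x` and
`y` is surjective. The two elements yield idempotents that separate the quaternion components from
the commutative ones and the two copies of the latter from each other; within each of these
blocks the Chinese remainder theorem applies. -/
theorem surjective_components (hm : 1 ≤ m) (h2 : (2 : K) ≠ 0) {A : Type*} [Ring A] [Algebra K A]
    (hp : ∏ i, p i = X ^ 2 ^ m - 1) (hr : ∏ j, r j = X ^ 2 ^ (m - 1) + 1)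
    (X₁ Y₁ : A) (f : A →ₐ[K] Components p r)
    (hfx : ∀ k, (f X₁).1 k = .root (p k.1))
    (hfy : ∀ k, (f Y₁).1 k = (if k.2 then 1 else -1) * .root (p k.1))
    (hgx : ∀ j, (f X₁).2 j = ⟨0, 1, 0, 0⟩) (hgy : ∀ j, (f Y₁).2 j = ⟨0, 0, 1, 0⟩) :
    Function.Surjective f := by
  have hps : Pairwise fun i j => IsCoprime (p i) (p j) := by
    refine Separable.pairwise_isCoprime_of_prod ?_
    rw [hp, X_pow_sub_one_separable_iff]
    push_cast
    exact pow_ne_zero _ h2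
  have hpr (i : ι) : AdjoinRoot.root (p i) ^ 2 ^ m = 1 := 
    AdjoinRoot.root_pow_eq_one (hp ▸ Finset.dvd_prod_of_mem p (Finset.mem_univ i))
  have hrs : Pairwise fun i j => IsCoprime (r i) (r j) := by
    refine Separable.pairwise_isCoprime_of_prod ?_
    have : (X ^ 2 ^ (m - 1) - C (-1 : K)).Separable :=
      separable_X_pow_sub_C _ (by push_cast; exact pow_ne_zero _ h2) (by simp)
    simpa [hr] using this
  have hrr (j : κ) : AdjoinRoot.root (r j) ^ 2 ^ (m - 1) = -1 := 
    AdjoinRoot.root_pow_eq_neg_one (hr ▸ Finset.dvd_prod_of_mem r (Finset.mem_univ j))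
  have hm' : 2 ^ m = 2 * 2 ^ (m - 1) := by rw [← pow_succ', Nat.sub_add_cancel hm]
  rintro ⟨u, h⟩
  obtain ⟨P₀, hP₀⟩ := AdjoinRoot.exists_forall_mk_eq hps fun i => u (i, true)
  obtain ⟨P₁, hP₁⟩ := AdjoinRoot.exists_forall_mk_eq hps fun i => u (i, false)
  obtain ⟨Q₀, hQ₀⟩ := AdjoinRoot.exists_forall_mk_eq hrs fun j => (h j).re
  obtain ⟨Q₁, hQ₁⟩ := AdjoinRoot.exists_forall_mk_eq hrs fun j => (h j).imI
  obtain ⟨Q₂, hQ₂⟩ := AdjoinRoot.exists_forall_mk_eq hrs fun j => (h j).imJ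
  obtain ⟨Q₃, hQ₃⟩ := AdjoinRoot.exists_forall_mk_eq hrs fun j => (h j).imK
  -- `Z` is the commutator of the two generators: `1` in the commutative components, and `-1` in
  -- the quaternion components; `W` is the sign by which the two copies of `K[X]/(p i)` differ.
  let Z := X₁ ^ 2 ^ m
  let W := X₁ ^ (2 ^ m - 1) * Y₁
  have hfW (k : ι × Bool) : (f W).1 k = if k.2 then 1 else -1 := by
    have : AdjoinRoot.root (p k.1) ^ (2 ^ m - 1) * AdjoinRoot.root (p k.1) = 1 := by
      rw [← pow_succ, Nat.sub_add_cancel Nat.one_le_two_pow, hpr]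
    simp only [W, map_mul, map_pow, Prod.fst_mul, Prod.pow_fst, Pi.mul_apply, Pi.pow_apply, hfx,
      hfy]
    rw [mul_left_comm, this, mul_one]
  have hfZ (k : ι × Bool) : (f Z).1 k = 1 := by
    simp [Z, hfx, hpr]
  have hgT (j : κ) : (f (X₁ ^ 2)).2 j = algebraMap _ _ (AdjoinRoot.root (r j)) := by
    simp only [map_pow, Prod.pow_snd, Pi.pow_apply, hgx, quaternion_i_sq]
    rfl
  have hgZ (j : κ) : (f Z).2 j = -1 := by
    have : Z = (X₁ ^ 2) ^ 2 ^ (m - 1) := by rw [← pow_mul, ← hm']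
    rw [this, map_pow, Prod.pow_snd, Pi.pow_apply, hgT, ← map_pow, hrr, map_neg, map_one]
  have hfP (P : K[X]) (k : ι × Bool) : (f (aeval X₁ P)).1 k = AdjoinRoot.mk (p k.1) P := by
    rw [← AdjoinRoot.aeval_eq, ← hfx k]
    exact (aeval_algHom_apply (((Pi.evalAlgHom K _ k).comp (AlgHom.fst K _ _)).comp f) X₁ P).symm
  have hgP (P : K[X]) (j : κ) :
      (f (aeval (X₁ ^ 2) P)).2 j = algebraMap _ _ (AdjoinRoot.mk (r j) P) := by
    rw [← AdjoinRoot.aeval_eq, ← aeval_algebraMap_apply, ← hgT j]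
    exact (aeval_algHom_apply (((Pi.evalAlgHom K _ j).comp (AlgHom.snd K _ _)).comp f) _ P).symm
  -- `e₀` and `e₁` project to the commutative and the quaternion components; among the former,
  -- `w₀` and `w₁` project to the copies indexed by `true` and by `false`.
  let e₀ := (2⁻¹ : K) • (1 + Z)
  let e₁ := (2⁻¹ : K) • (1 - Z)
  let w₀ := (2⁻¹ : K) • (1 + W)
  let w₁ := (2⁻¹ : K) • (1 - W)
  have hfe₀ (k : ι × Bool) : (f e₀).1 k = 1 := by
    simp [e₀, hfZ, inv_two_smul_one_add_one h2, -smul_add]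
  have hge₀ (j : κ) : (f e₀).2 j = 0 := by
    simp [e₀, hgZ, -smul_add]
  have hfe₁ (k : ι × Bool) : (f e₁).1 k = 0 := by
    simp [e₁, hfZ]
  have hge₁ (j : κ) : (f e₁).2 j = 1 := by
    simp [e₁, hgZ, inv_two_smul_one_add_one h2, -smul_add]
  have hw₀ (k : ι × Bool) : (f w₀).1 k = if k.2 then 1 else 0 := by
    obtain ⟨i, _ | _⟩ := k <;> simp [w₀, hfW, inv_two_smul_one_add_one h2, -smul_add]
  have hw₁ (k : ι × Bool) : (f w₁).1 k = if k.2 then 0 else 1 := by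
    obtain ⟨i, _ | _⟩ := k <;> simp [w₁, hfW, inv_two_smul_one_add_one h2, -smul_add]
  refine ⟨e₀ * (w₀ * aeval X₁ P₀ + w₁ * aeval X₁ P₁) + e₁ * (aeval (X₁ ^ 2) Q₀ +
    aeval (X₁ ^ 2) Q₁ * X₁ + aeval (X₁ ^ 2) Q₂ * Y₁ + aeval (X₁ ^ 2) Q₃ * (X₁ * Y₁)),
    Prod.ext (funext fun k => ?_) (funext fun j => ?_)⟩
  · simp only [map_add, map_mul, Prod.fst_add, Prod.fst_mul, Pi.add_apply, Pi.mul_apply, hfe₀,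
      hfe₁, hw₀, hw₁, hfP]
    obtain ⟨i, _ | _⟩ := k <;> simp [hP₀, hP₁]
  · simp only [map_add, map_mul, Prod.snd_add, Prod.snd_mul, Pi.add_apply, Pi.mul_apply, hge₀,
      hge₁, hgP, hQ₀, hQ₁, hQ₂, hQ₃, hgx, hgy]
    ext <;> simp [QuaternionAlgebra.algebraMap_eq]

theorem sum_natDegree_eq {n : ℕ} (hn : n ≠ 0) {c : K} {s : ι → K[X]} (hs : ∏ i, s i = X ^ n - C c) :
    ∑ i, (s i).natDegree = n := by
  have h0 : X ^ n - C c ≠ 0 := X_pow_sub_C_ne_zero (Nat.pos_of_ne_zero hn) c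
  have hs0 (i : ι) : s i ≠ 0 := fun hi => h0 (hs ▸ Finset.prod_eq_zero (Finset.mem_univ i) hi)
  rw [← natDegree_prod _ _ fun i _ => hs0 i, hs, natDegree_X_pow_sub_C]

/-- The components have total dimension `2 ^ m + 2 ^ m + 4 * 2 ^ (m - 1)`, the upper bound for the
order of the group. -/
theorem finrank_components (hm : 1 ≤ m)
    (hp : ∏ i, p i = X ^ 2 ^ m - 1) (hr : ∏ j, r j = X ^ 2 ^ (m - 1) + 1) :
    Module.Finite K (Components p r) ∧ Module.finrank K (Components p r) = 4 * 2 ^ m := by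
  have hp' : ∏ i, p i = X ^ 2 ^ m - C 1 := by simpa using hp
  have hr' : ∏ j, r j = X ^ 2 ^ (m - 1) - C (-1) := by simpa using hr
  have hp0 (i : ι) : p i ≠ 0 := fun h =>
    X_pow_sub_C_ne_zero (Nat.two_pow_pos m) (1 : K)
      (hp' ▸ Finset.prod_eq_zero (Finset.mem_univ i) h)
  have hr0 (j : κ) : r j ≠ 0 := fun h =>
    X_pow_sub_C_ne_zero (Nat.two_pow_pos (m - 1)) (-1 : K)
      (hr' ▸ Finset.prod_eq_zero (Finset.mem_univ j) h)
  have (i : ι) : Module.Finite K (AdjoinRoot (p i)) := (AdjoinRoot.powerBasis (hp0 i)).finite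
  have (j : κ) : Module.Finite K (AdjoinRoot (r j)) := (AdjoinRoot.powerBasis (hr0 j)).finite
  let e (j : κ) := (QuaternionAlgebra.linearEquivTuple (AdjoinRoot.root (r j)) 0
    (AdjoinRoot.root (r j))).restrictScalars K
  have (j : κ) : Module.Finite K
      ℍ[AdjoinRoot (r j), AdjoinRoot.root (r j), AdjoinRoot.root (r j)] :=
    Module.Finite.equiv (e j).symm
  refine ⟨inferInstance, ?_⟩
  have h1 (i : ι) : Module.finrank K (AdjoinRoot (p i)) = (p i).natDegree :=
    finrank_quotient_span_eq_natDegree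
  have h2 (j : κ) : Module.finrank K
      ℍ[AdjoinRoot (r j), AdjoinRoot.root (r j), AdjoinRoot.root (r j)] = 4 * (r j).natDegree := by
    rw [(e j).finrank_eq, Module.finrank_pi_fintype, Finset.sum_const,
      show Module.finrank K (AdjoinRoot (r j)) = (r j).natDegree from
        finrank_quotient_span_eq_natDegree]
    simp
  rw [Module.finrank_prod, Module.finrank_pi_fintype, Module.finrank_pi_fintype,
    Fintype.sum_prod_type]
  simp only [h1, h2, Fintype.sum_bool, ← Finset.mul_sum, ← two_mul]
  rw [sum_natDegree_eq (by positivity) hp', sum_natDegree_eq (by positivity) hr']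
  obtain ⟨n, rfl⟩ := Nat.exists_eq_add_of_le' hm
  simp [pow_succ]; ring

/-- The decomposition of the group algebra attached to factorizations of `X ^ 2 ^ m - 1` and
`X ^ 2 ^ (m - 1) + 1`. The order of the group comes with it: it is at least the dimension of the
components, by surjectivity, and at most that number, by the normal form of its elements. -/
theorem nonempty_algEquiv_components (hm : 1 ≤ m) (h2 : (2 : K) ≠ 0)
    (hp : ∏ i, p i = X ^ 2 ^ m - 1) (hr : ∏ j, r j = X ^ 2 ^ (m - 1) + 1) :
    Nonempty (MonoidAlgebra K (PresentedGroup (D2Rels m)) ≃ₐ[K] Components p r) ∧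
      Nat.card (PresentedGroup (D2Rels m)) = 4 * 2 ^ m := by
  choose f hfx hfy using fun k : ι × Bool => exists_algHom_adjoinRoot hm
    (hp ▸ Finset.dvd_prod_of_mem p (Finset.mem_univ k.1)) k.2
  choose g hgx hgy using fun j : κ => exists_algHom_quaternion hm
    (hr ▸ Finset.dvd_prod_of_mem r (Finset.mem_univ j))
  let F : MonoidAlgebra K (PresentedGroup (D2Rels m)) →ₐ[K] Components p r :=
    (AlgHom.pi f).prod (AlgHom.pi g)
  have hF : Function.Surjective F :=
    surjective_components hm h2 hp hr (MonoidAlgebra.of K _ (x m))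
      (MonoidAlgebra.of K _ (y m)) F hfx hfy hgx hgy
  obtain ⟨_, hrank⟩ := finrank_components hm hp hr
  have hcard := Module.finrank_eq_nat_card_basis (MonoidAlgebra.basis (PresentedGroup (D2Rels m)) K)
  have : Module.Finite K (MonoidAlgebra K (PresentedGroup (D2Rels m))) :=
    .of_basis (MonoidAlgebra.basis _ K)
  have hle : Module.finrank K (Components p r) ≤ _ :=
    LinearMap.finrank_le_finrank_of_surjective (f := F.toLinearMap) hF
  have heq : Nat.card (PresentedGroup (D2Rels m)) = 4 * 2 ^ m :=
    card_le.antisymm (by rwa [hrank, hcard] at hle)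
  refine ⟨⟨AlgEquiv.ofBijective F ⟨?_, hF⟩⟩, heq⟩
  exact (LinearMap.injective_iff_surjective_of_finrank_eq_finrank (f := F.toLinearMap)
    (by rw [hcard, heq, hrank])).2 hF

end D2

/-! ### Simple components of a product of rings -/

section SimpleComponents

variable {ι : Type*} {R : Type*} [Ring R] {S : ι → Type*} [∀ i, Ring (S i)]

/-- The `i`-th component of a ring `R ≃+* Π i, S i`: the two-sided ideal of the elements all of
whose coordinates other than the `i`-th vanish. -/
def componentIdeal (e : R ≃+* Π i, S i) (i : ι) : TwoSidedIdeal R :=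
  TwoSidedIdeal.mk' {r | ∀ j, j ≠ i → e r j = 0} (by simp)
    (fun {a b} ha hb j hj => by simp [ha j hj, hb j hj])
    (fun {a} ha j hj => by simp [ha j hj])
    (fun {a b} hb j hj => by simp [hb j hj])
    (fun {a b} ha j hj => by simp [ha j hj])

theorem mem_componentIdeal {e : R ≃+* Π i, S i} {i : ι} {r : R} :
    r ∈ componentIdeal e i ↔ ∀ j, j ≠ i → e r j = 0 := by
  simp [componentIdeal]

theorem componentIdeal_ne_bot [∀ i, Nontrivial (S i)] (e : R ≃+* Π i, S i) (i : ι) :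
    componentIdeal e i ≠ ⊥ := by
  classical
  intro h
  have hmem : e.symm (Pi.single i 1) ∈ componentIdeal e i :=
    mem_componentIdeal.2 fun j hj => by simp [hj]
  rw [h, TwoSidedIdeal.mem_bot, map_eq_zero_iff _ e.symm.injective] at hmem
  simpa using congrFun hmem i

theorem disjoint_componentIdeal (e : R ≃+* Π i, S i) {i j : ι} (hij : i ≠ j) :
    Disjoint (componentIdeal e i) (componentIdeal e j) := by
  rw [disjoint_iff_inf_le]
  intro r hr
  rw [TwoSidedIdeal.mem_inf, mem_componentIdeal, mem_componentIdeal] at hr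
  rw [TwoSidedIdeal.mem_bot, ← map_eq_zero_iff _ e.injective]
  funext k
  by_cases hk : k = i
  · exact hr.2 k (hk ▸ hij)
  · exact hr.1 k hk

instance finite_twoSidedIdeal [Finite R] : Finite (TwoSidedIdeal R) :=
  Finite.of_injective (fun I : TwoSidedIdeal R => (I : Set R)) SetLike.coe_injective

/-- A finite ring that is a product of nonzero rings has at least as many minimal ideals as it
has factors: each factor contains one, and the factors are pairwise disjoint. Finiteness of `R`
provides the minimal ideals, and makes their number, an `ncard`, meaningful. -/
theorem card_le_numSimpleComponents [Finite R] [∀ i, Nontrivial (S i)] (e : R ≃+* Π i, S i) :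
    Nat.card ι ≤ numSimpleComponents R := by
  have h (i : ι) : ∃ I : TwoSidedIdeal R, IsAtom I ∧ I ≤ componentIdeal e i :=
    (eq_bot_or_exists_atom_le _).resolve_left (componentIdeal_ne_bot e i)
  choose I hI hle using h
  have hinj : Function.Injective fun i => (⟨I i, hI i⟩ : {I : TwoSidedIdeal R | IsAtom I}) := by
    intro i j hij
    by_contra hne
    have hij : I i = I j := congrArg Subtype.val hij
    exact (hI i).1 (le_bot_iff.1 (disjoint_componentIdeal e hne (hle i) (hij ▸ hle j)))
  exact Nat.card_le_card_of_injective _ hinj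

/-- If all factors are simple, every minimal two-sided ideal is one of the factors. -/
theorem numSimpleComponents_le [Finite ι] [∀ i, IsSimpleRing (S i)] (e : R ≃+* Π i, S i) :
    numSimpleComponents R ≤ Nat.card ι := by
  classical
  have hsub : {I : TwoSidedIdeal R | IsAtom I} ⊆ Set.range (componentIdeal e) := by
    intro I hI
    obtain ⟨r, hr, hr0⟩ : ∃ r ∈ I, r ≠ 0 := by
      by_contra! h
      exact hI.1 (le_bot_iff.1 fun r hr => (TwoSidedIdeal.mem_bot R).2 (h r hr))
    obtain ⟨i, hi⟩ : ∃ i, e r i ≠ 0 := by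
      by_contra! h
      exact hr0 ((map_eq_zero_iff _ e.injective).1 (funext h))
    refine ⟨i, ((hI.le_iff_eq (componentIdeal_ne_bot e i)).1 ?_)⟩
    let J : TwoSidedIdeal (S i) :=
      TwoSidedIdeal.mk' {s | e.symm (Pi.single i s) ∈ I} (by simp [I.zero_mem])
        (fun {a b} ha hb => by simpa [Pi.single_add] using I.add_mem ha hb)
        (fun {a} ha => by simpa [Pi.single_neg] using I.neg_mem ha)
        (fun {a b} hb => by
          simpa [Pi.single_mul] using I.mul_mem_left (e.symm (Pi.single i a)) _ hb)
        (fun {a b} ha => by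
          simpa [Pi.single_mul] using I.mul_mem_right _ (e.symm (Pi.single i b)) ha)
    have hmem {s : S i} : s ∈ J ↔ e.symm (Pi.single i s) ∈ I := by simp [J]
    have hJ : (1 : S i) ∈ J := by
      refine IsSimpleRing.one_mem_of_ne_zero_mem J hi (hmem.2 ?_)
      have : e.symm (Pi.single i (e r i)) = e.symm (Pi.single i 1) * r := by
        apply e.injective
        funext j
        obtain rfl | hj := eq_or_ne j i <;> simp [*]
      rw [this]
      exact I.mul_mem_left _ _ hr
    intro s hs
    have : s = e.symm (Pi.single i 1) * s := by
      apply e.injective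
      funext j
      obtain rfl | hj := eq_or_ne j i
      · simp
      · simp [hj, mem_componentIdeal.1 hs j hj]
    rw [this]
    exact I.mul_mem_right _ _ (hmem.1 hJ)
  calc numSimpleComponents R ≤ (Set.range (componentIdeal e)).ncard :=
        Set.ncard_le_ncard hsub (Set.finite_range _)
    _ = Nat.card (Set.range (componentIdeal e)) := rfl
    _ ≤ Nat.card ι := Finite.card_range_le _

end SimpleComponents

section Prod

universe w

variable {ι κ : Type*} {R : Type*} [Ring R] {S : ι → Type w} {T : κ → Type w}
  [∀ i, Ring (S i)] [∀ j, Ring (T j)]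

/-- The ring structures of two families of rings, as a family over the disjoint union of the
index types. -/
@[reducible] def sumElimRing : ∀ k, Ring (Sum.elim S T k)
  | .inl i => inferInstanceAs (Ring (S i))
  | .inr j => inferInstanceAs (Ring (T j))

attribute [local instance] sumElimRing

/-- A product of two families of rings, as the product of a single family. -/
def RingEquiv.sumPiSymm : ((Π i, S i) × Π j, T j) ≃+* Π k, Sum.elim S T k where
  __ := (Equiv.sumPiEquivProdPi (Sum.elim S T)).symm
  map_mul' _ _ := by funext k; cases k <;> rfl
  map_add' _ _ := by funext k; cases k <;> rfl

theorem card_add_card_le_numSimpleComponents [Finite ι] [Finite κ] [Finite R]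
    [∀ i, Nontrivial (S i)] [∀ j, Nontrivial (T j)] (e : R ≃+* (Π i, S i) × Π j, T j) :
    Nat.card ι + Nat.card κ ≤ numSimpleComponents R := by
  have (k : ι ⊕ κ) : Nontrivial (Sum.elim S T k) := by
    cases k
    · exact inferInstanceAs (Nontrivial (S _))
    · exact inferInstanceAs (Nontrivial (T _))
  rw [← Nat.card_sum]
  exact card_le_numSimpleComponents (e.trans RingEquiv.sumPiSymm)

theorem numSimpleComponents_le_card_add_card [Finite ι] [Finite κ]
    [∀ i, IsSimpleRing (S i)] [∀ j, IsSimpleRing (T j)] (e : R ≃+* (Π i, S i) × Π j, T j) :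
    numSimpleComponents R ≤ Nat.card ι + Nat.card κ := by
  have (k : ι ⊕ κ) : IsSimpleRing (Sum.elim S T k) := by
    cases k
    · exact inferInstanceAs (IsSimpleRing (S _))
    · exact inferInstanceAs (IsSimpleRing (T _))
  rw [← Nat.card_sum]
  exact numSimpleComponents_le (e.trans RingEquiv.sumPiSymm)

end Prod

/-! ### Factorizations of `X ^ 2 ^ m - 1` -/

section Factorization

variable {K : Type*} [Field K]

theorem X_pow_two_pow_succ_sub_one (m : ℕ) :
    (X ^ 2 ^ (m + 1) - 1 : K[X]) = (X ^ 2 ^ m + 1) * (X ^ 2 ^ m - 1) := by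
  rw [pow_succ, pow_mul]; ring

theorem cyclotomic_two_pow_succ (R : Type*) [CommRing R] (k : ℕ) :
    cyclotomic (2 ^ (k + 1)) R = X ^ 2 ^ k + 1 := by
  rw [cyclotomic_prime_pow_eq_geom_sum Nat.prime_two]
  simp [Finset.sum_range_succ, add_comm]

theorem irreducible_X_pow_two_pow_add_one_rat (k : ℕ) : Irreducible (X ^ 2 ^ k + 1 : ℚ[X]) := by
  rw [← cyclotomic_two_pow_succ]
  exact cyclotomic.irreducible_rat (by positivity)

/-- Over `ℚ` the polynomial `X ^ 2 ^ m - 1` has `m + 1` irreducible factors. -/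
theorem exists_factorization_rat (m : ℕ) :
    ∃ p : Fin (m + 1) → ℚ[X], (∀ i, Irreducible (p i)) ∧ ∏ i, p i = X ^ 2 ^ m - 1 := by
  induction m with
  | zero => exact ⟨fun _ => X - 1, fun _ => by simpa using irreducible_X_sub_C (1 : ℚ), by simp⟩
  | succ m ih =>
    obtain ⟨p, hp, hprod⟩ := ih
    refine ⟨Fin.cons (X ^ 2 ^ m + 1) p,
      Fin.cases (irreducible_X_pow_two_pow_add_one_rat m) hp, ?_⟩
    rw [Fin.prod_cons, hprod, X_pow_two_pow_succ_sub_one]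

variable [Finite K]

/-- In a finite field, one of `-1`, `2` and `-2` is a square, so that `X ^ 4 + 1` is a product of
two quadratic polynomials. -/
theorem exists_mul_eq_X_pow_add_one_of_natDegree_eq (k : ℕ) :
    ∃ f g : K[X], f * g = X ^ 2 ^ (k + 2) + 1 ∧ f.natDegree = 2 ^ (k + 1) ∧
      g.natDegree = 2 ^ (k + 1) := by
  have := Fintype.ofFinite K
  have h4 : (X ^ 2 ^ (k + 2) + 1 : K[X]) = (X ^ 2 ^ k) ^ 4 + 1 := by
    rw [← pow_mul, pow_add]; norm_num
  have hdeg (f : K[X]) (hf : f.natDegree = 2) :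
      (f.comp (X ^ 2 ^ k)).natDegree = 2 ^ (k + 1) := by
    rw [natDegree_comp, hf, natDegree_X_pow, pow_succ']
  suffices ∃ f g : K[X], f * g = X ^ 4 + 1 ∧ f.natDegree = 2 ∧ g.natDegree = 2 by
    obtain ⟨f, g, hfg, hf, hg⟩ := this
    refine ⟨f.comp (X ^ 2 ^ k), g.comp (X ^ 2 ^ k), ?_, hdeg f hf, hdeg g hg⟩
    rw [← mul_comp, hfg, h4]
    simp
  by_cases hm1 : IsSquare (-1 : K)
  · obtain ⟨s, hs⟩ := hm1
    refine ⟨X ^ 2 + C s, X ^ 2 - C s, ?_, by compute_degree!, by compute_degree!⟩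
    have : C s * C s = (-1 : K[X]) := by rw [← C_mul, ← hs]; simp
    linear_combination -this
  by_cases hs2 : IsSquare (2 : K)
  · obtain ⟨s, hs⟩ := hs2
    refine ⟨X ^ 2 + C s * X + 1, X ^ 2 - C s * X + 1, ?_, by compute_degree!, by compute_degree!⟩
    have : C s * C s = (2 : K[X]) := by rw [← C_mul, ← hs]; rfl
    linear_combination -X ^ 2 * this
  · obtain ⟨s, hs⟩ : IsSquare (-2 : K) := by
      rw [FiniteField.isSquare_neg_one_iff] at hm1
      rw [FiniteField.isSquare_two_iff] at hs2
      rw [FiniteField.isSquare_neg_two_iff]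
      omega
    refine ⟨X ^ 2 + C s * X - 1, X ^ 2 - C s * X - 1, ?_, by compute_degree!, by compute_degree!⟩
    have : C s * C s = (-2 : K[X]) := by rw [← C_mul, ← hs, C_neg]; rfl
    linear_combination -X ^ 2 * this

/-- A number congruent to `3` modulo `8` has order `2 ^ (k + 1)` modulo `2 ^ (k + 3)`. -/
theorem orderOf_eq_of_mod_eight_eq_three {q k : ℕ} (hq : q % 8 = 3) (u : (ZMod (2 ^ (k + 3)))ˣ)
    (hu : (u : ZMod (2 ^ (k + 3))) = q) : orderOf u = 2 ^ (k + 1) := by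
  -- the exact power of `2` dividing `q ^ 2 ^ (j + 1) - 1` is `2 ^ (j + 3)`
  have hpow (j : ℕ) : ∃ c : ℕ, q ^ 2 ^ (j + 1) = 1 + 2 ^ (j + 3) * (2 * c + 1) := by
    induction j with
    | zero =>
      obtain ⟨a, rfl⟩ : ∃ a, q = 8 * a + 3 := ⟨q / 8, by omega⟩
      exact ⟨4 * a ^ 2 + 3 * a, by ring⟩
    | succ j ih =>
      obtain ⟨c, hc⟩ := ih
      refine ⟨c + 2 ^ (j + 1) * (2 * c + 1) ^ 2, ?_⟩
      rw [pow_succ 2 (j + 1), pow_mul, hc]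
      ring
  have hval (n : ℕ) : u ^ n = 1 ↔ ((q ^ n : ℕ) : ZMod (2 ^ (k + 3))) = (1 : ℕ) := by
    rw [← Units.val_inj]; push_cast; rw [hu]
  refine orderOf_eq_prime_pow ?_ ?_
  · rw [hval]
    obtain _ | k := k
    · rw [ZMod.natCast_eq_natCast_iff']
      simp; omega
    · obtain ⟨c, hc⟩ := hpow k
      rw [hc, Nat.cast_add, add_eq_left, ZMod.natCast_eq_zero_iff, pow_succ 2 (k + 3),
        Nat.mul_dvd_mul_iff_left (by positivity)]
      omega
  · rw [hval]
    obtain ⟨c, hc⟩ := hpow k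
    rw [hc, Nat.cast_add, add_eq_left, ZMod.natCast_eq_zero_iff]
    exact dvd_mul_right _ _

/-- All irreducible factors of `X ^ 2 ^ (k + 2) + 1`, a cyclotomic polynomial, have the order of
`Nat.card K` modulo `2 ^ (k + 3)` as their degree. -/
theorem irreducible_of_dvd_X_pow_two_pow_add_one (hq : Nat.card K % 8 = 3) {k : ℕ} {f : K[X]}
    (hf : f ∣ X ^ 2 ^ (k + 2) + 1) (hdeg : f.natDegree = 2 ^ (k + 1)) : Irreducible f := by
  have := Fintype.ofFinite K
  rw [Nat.card_eq_fintype_card] at hq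
  obtain ⟨p, _, n, hp, hcard⟩ := FiniteField.card' K
  have : Fact p.Prime := ⟨hp⟩
  have hodd : Odd p := by
    have : Odd (p ^ (n : ℕ)) := by rw [← hcard, Nat.odd_iff]; omega
    exact (Nat.odd_pow_iff n.ne_zero).1 this
  have hcop : p.Coprime (2 ^ (k + 3)) := (Nat.coprime_two_right.2 hodd).pow_right _
  refine irreducible_of_dvd_cyclotomic_of_natDegree hcard hcop ?_ ?_
  · rwa [cyclotomic_two_pow_succ]
  · rw [hdeg, orderOf_eq_of_mod_eight_eq_three hq]
    rw [ZMod.coe_unitOfCoprime, hcard]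

variable (K) in
theorem exists_mul_eq_X_pow_add_one (k : ℕ) :
    ∃ f g : K[X], f * g = X ^ 2 ^ (k + 2) + 1 ∧ 0 < f.natDegree ∧ 0 < g.natDegree ∧
      (Nat.card K % 8 = 3 → Irreducible f ∧ Irreducible g) := by
  obtain ⟨f, g, hfg, hf, hg⟩ := exists_mul_eq_X_pow_add_one_of_natDegree_eq (K := K) k
  exact ⟨f, g, hfg, hf ▸ Nat.two_pow_pos _, hg ▸ Nat.two_pow_pos _, fun hq =>
    ⟨irreducible_of_dvd_X_pow_two_pow_add_one hq (hfg ▸ dvd_mul_right f g) hf,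
      irreducible_of_dvd_X_pow_two_pow_add_one hq (hfg ▸ dvd_mul_left g f) hg⟩⟩

theorem irreducible_X_sq_add_one (hq : Nat.card K % 8 = 3) : Irreducible (X ^ 2 + 1 : K[X]) := by
  have := Fintype.ofFinite K
  have : ¬ IsSquare (-1 : K) := by
    rw [FiniteField.isSquare_neg_one_iff, ← Nat.card_eq_fintype_card]
    omega
  have h := X_pow_sub_C_irreducible_of_prime Nat.prime_two (a := (-1 : K))
    fun b hb => this ⟨b, by rw [← hb, sq]⟩
  simpa using h

variable (K) in
/-- Over a finite field, `X ^ 2 ^ (n + 2) - 1` is a product of `2 * n + 3` nonconstant factors: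
`X - 1`, `X + 1`, `X ^ 2 + 1`, and two for each `X ^ 2 ^ k + 1` with `2 ≤ k ≤ n + 1`. -/
theorem exists_factorization_finite (n : ℕ) :
    ∃ p : Fin (2 * n + 3) → K[X], (∀ i, 0 < (p i).natDegree) ∧
      (Nat.card K % 8 = 3 → ∀ i, Irreducible (p i)) ∧ ∏ i, p i = X ^ 2 ^ (n + 2) - 1 := by
  induction n with
  | zero =>
    have h1 : (X - 1 : K[X]).natDegree = 1 := by compute_degree!
    have h2 : (X + 1 : K[X]).natDegree = 1 := by compute_degree!
    have h3 : (X ^ 2 + 1 : K[X]).natDegree = 2 := by compute_degree!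
    refine ⟨![X - 1, X + 1, X ^ 2 + 1], fun i => ?_, fun hq i => ?_, ?_⟩
    · fin_cases i
      · simp [h1]
      · simp [h2]
      · simp [h3]
    · fin_cases i
      · exact irreducible_of_degree_eq_one (degree_eq_iff_natDegree_eq_of_pos one_pos |>.2 h1)
      · exact irreducible_of_degree_eq_one (degree_eq_iff_natDegree_eq_of_pos one_pos |>.2 h2)
      · exact irreducible_X_sq_add_one hq
    · simp [Fin.prod_univ_three]; ring
  | succ n ih =>
    obtain ⟨p, hpos, hirr, hprod⟩ := ih
    obtain ⟨f, g, hfg, hf, hg, hfg'⟩ := exists_mul_eq_X_pow_add_one K n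
    refine ⟨(Fin.cons f (Fin.cons g p : Fin (2 * n + 4) → K[X]) : Fin (2 * n + 5) → K[X]),
      Fin.cases hf (Fin.cases hg hpos),
      fun hq => Fin.cases (hfg' hq).1 (Fin.cases (hfg' hq).2 (hirr hq)), ?_⟩
    refine (Fin.prod_univ_succ _).trans ?_
    rw [Fin.cons_zero]
    simp only [Fin.cons_succ]
    rw [Fin.prod_cons]
    have : f * (g * ∏ i, p i) = X ^ 2 ^ (n + 2 + 1) - 1 := by
      rw [hprod, ← mul_assoc, hfg, ← X_pow_two_pow_succ_sub_one]
    exact this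

end Factorization

/-! ### Split quaternion algebras -/

section Split

variable {E : Type*} [Field E]

/-- Over a field containing a square root of `-1`, the quaternion algebra with both parameters
equal to `c` is a matrix algebra: `i⁻¹ * j` squares to `-1` and can be sent to
`diag(d, -d)`. -/
theorem nonempty_quaternion_algEquiv_matrix (h2 : (2 : E) ≠ 0) {c d : E} (hc : c ≠ 0)
    (hd : d ^ 2 = -1) : Nonempty (ℍ[E, c, c] ≃ₐ[E] Matrix (Fin 2) (Fin 2) E) := by
  have hd0 : d ≠ 0 := by
    rintro rfl
    simp at hd
  let B : QuaternionAlgebra.Basis (Matrix (Fin 2) (Fin 2) E) c 0 c :=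
    { i := !![0, c; 1, 0]
      j := !![0, -c * d; d, 0]
      k := !![c * d, 0; 0, -c * d]
      i_mul_i := by
        ext i j; fin_cases i <;> fin_cases j <;> simp [Matrix.mul_apply]
      j_mul_j := by
        ext i j
        fin_cases i <;> fin_cases j <;> simp [Matrix.mul_apply] <;> linear_combination -c * hd
      i_mul_j := by
        ext i j; fin_cases i <;> fin_cases j <;> simp [Matrix.mul_apply]
      j_mul_i := by
        ext i j; fin_cases i <;> fin_cases j <;> simp [Matrix.mul_apply]; ring }
  have hinj : Function.Injective B.liftHom := by
    rw [injective_iff_map_eq_zero]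
    intro a ha
    have key (i j : Fin 2) : B.lift a i j = 0 := congrFun (congrFun ha i) j
    have h00 := key 0 0
    have h01 := key 0 1
    have h10 := key 1 0
    have h11 := key 1 1
    simp [QuaternionAlgebra.Basis.lift, B, Algebra.algebraMap_eq_smul_one] at h00 h01 h10 h11
    have hK : a.imK = 0 := by
      have : 2 * c * d * a.imK = 0 := by linear_combination h00 - h11
      simpa [h2, hc, hd0] using this
    have hJ : a.imJ = 0 := by
      have : 2 * c * d * a.imJ = 0 := by linear_combination c * h10 - h01
      simpa [h2, hc, hd0] using this
    ext
    · simpa [hK] using h00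
    · simpa [hJ] using h10
    · exact hJ
    · exact hK
  refine ⟨AlgEquiv.ofBijective B.liftHom ⟨hinj, ?_⟩⟩
  refine (LinearMap.injective_iff_surjective_of_finrank_eq_finrank
    (f := B.liftHom.toLinearMap) ?_).1 hinj
  rw [QuaternionAlgebra.finrank_eq_four, Module.finrank_matrix]
  simp

end Split

/-! ### The group algebra of a group of type `D₂` -/

namespace IsTypeD2

variable {m : ℕ} {G : Type*} [Group G]

protected theorem finite (hG : IsTypeD2 m G) : Finite G :=
  hG.elim fun e => .of_equiv _ e.symm.toEquiv

variable {K ι κ : Type*} [Field K] [Fintype ι] [Fintype κ] {p : ι → K[X]} {r : κ → K[X]}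

/-- The decomposition of the group algebra into components, with the commutative ones numbered. -/
theorem nonempty_algEquiv (hG : IsTypeD2 m G) (hm : 1 ≤ m) (h2 : (2 : K) ≠ 0)
    (hp : ∏ i, p i = X ^ 2 ^ m - 1) (hr : ∏ j, r j = X ^ 2 ^ (m - 1) + 1)
    {N : ℕ} (hN : N = 2 * Fintype.card ι) :
    ∃ σ : Fin N → ι, Nonempty (MonoidAlgebra K G ≃ₐ[K] (∀ n, AdjoinRoot (p (σ n))) ×
      ∀ j, ℍ[AdjoinRoot (r j), AdjoinRoot.root (r j), AdjoinRoot.root (r j)]) := by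
  obtain ⟨e⟩ := hG
  obtain ⟨⟨φ⟩, -⟩ := D2.nonempty_algEquiv_components hm h2 hp hr
  let τ : Fin N ≃ ι × Bool :=
    Fintype.equivOfCardEq (by simp [hN, mul_comm])
  exact ⟨fun n => (τ n).1, ⟨((MonoidAlgebra.domCongr K K e).trans φ).trans
    (AlgEquiv.prodCongr (AlgEquiv.piCongrLeft K (fun k : ι × Bool => AdjoinRoot (p k.1)) τ).symm
      AlgEquiv.refl)⟩⟩

theorem natCard (hG : IsTypeD2 m G) (hm : 1 ≤ m) : Nat.card G = 4 * 2 ^ m := by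
  obtain ⟨e⟩ := hG
  rw [Nat.card_congr e.toEquiv]
  exact (D2.nonempty_algEquiv_components (K := ℚ) (p := fun _ : Unit => X ^ 2 ^ m - 1)
    (r := fun _ : Unit => X ^ 2 ^ (m - 1) + 1) hm two_ne_zero (by simp) (by simp)).2

theorem isSemisimpleRing (hG : IsTypeD2 m G) (hm : 1 ≤ m) (h2 : (2 : K) ≠ 0) :
    IsSemisimpleRing (MonoidAlgebra K G) := by
  have := hG.finite
  have : NeZero (Nat.card G : K) := ⟨by
    rw [hG.natCard hm]
    push_cast
    rw [show (4 : K) = 2 ^ 2 by norm_num]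
    positivity⟩
  infer_instance

end IsTypeD2

theorem two_ne_zero_of_odd_natCard {K : Type*} [Field K] [Finite K] (h : Odd (Nat.card K)) :
    (2 : K) ≠ 0 := by
  have := Fintype.ofFinite K
  refine Ring.two_ne_zero fun hK => ?_
  have := FiniteField.even_card_of_char_two hK
  rw [← Nat.card_eq_fintype_card] at this
  exact Nat.not_even_iff_odd.2 h (Nat.even_iff.2 this)

theorem AdjoinRoot.root_ne_zero_of_dvd {K : Type*} [Field K] {q : K[X]} [Nontrivial (AdjoinRoot q)]
    {k : ℕ} (h : q ∣ X ^ 2 ^ k + 1) : AdjoinRoot.root q ≠ 0 := by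
  intro h0
  have := AdjoinRoot.root_pow_eq_neg_one h
  simp [h0] at this

theorem mainTheorem2 (m : ℕ) (hm : 3 ≤ m) (G : Type u) [Group G] (hG : IsTypeD2 m G) :
    (∃ (L : Fin (2 * m + 2) → Type) (_ : ∀ i, Field (L i)) (_ : ∀ i, Algebra ℚ (L i))
        (E : Type) (_ : Field E) (_ : Algebra ℚ E) (a b : E),
        a ≠ 0 ∧ b ≠ 0 ∧
        Nonempty (MonoidAlgebra ℚ G ≃ₐ[ℚ] (∀ i, L i) × ℍ[E, a, b])) ∧
    (∀ (K : Type v) [Field K] [Finite K], Odd (Nat.card K) →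
        IsSemisimpleRing (MonoidAlgebra K G) ∧
        4 * m ≤ numSimpleComponents (MonoidAlgebra K G) ∧
        (Nat.card K % 8 = 3 →
          numSimpleComponents (MonoidAlgebra K G) = 4 * m ∧
          ∃ (L : Fin (4 * m - 2) → Type v) (_ : ∀ i, Field (L i)) (_ : ∀ i, Algebra K (L i))
            (E : Fin 2 → Type v) (_ : ∀ j, Field (E j)) (_ : ∀ j, Algebra K (E j))
            (a b : ∀ j, E j),
            (∀ j, a j ≠ 0 ∧ b j ≠ 0) ∧
            Nonempty (MonoidAlgebra K G ≃ₐ[K] (∀ i, L i) × (∀ j, ℍ[E j, a j, b j])) ∧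
            ∀ j, Nonempty (ℍ[E j, a j, b j] ≃ₐ[E j] Matrix (Fin 2) (Fin 2) (E j)))) := by
  have := hG.finite
  refine ⟨?_, fun K _ _ hK => ?_⟩
  · obtain ⟨p, hp, hprod⟩ := exists_factorization_rat m
    have hr := irreducible_X_pow_two_pow_add_one_rat (m - 1)
    obtain ⟨σ, ⟨φ⟩⟩ := hG.nonempty_algEquiv (κ := Unit) (r := fun _ => X ^ 2 ^ (m - 1) + 1)
      (by omega) two_ne_zero hprod (by simp) (N := 2 * m + 2) (by simp; ring)
    have (i : _) : Fact (Irreducible (p i)) := ⟨hp i⟩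
    have : Fact (Irreducible (X ^ 2 ^ (m - 1) + 1 : ℚ[X])) := ⟨hr⟩
    have h0 := AdjoinRoot.root_ne_zero_of_dvd (dvd_refl (X ^ 2 ^ (m - 1) + 1 : ℚ[X]))
    exact ⟨fun n => AdjoinRoot (p (σ n)), fun n => inferInstanceAs (Field (AdjoinRoot _)),
      fun n => inferInstanceAs (Algebra ℚ (AdjoinRoot _)),
      AdjoinRoot (X ^ 2 ^ (m - 1) + 1), inferInstance, inferInstance, .root _, .root _, h0, h0,
      ⟨φ.trans (AlgEquiv.prodCongr AlgEquiv.refl (AlgEquiv.funUnique ℚ Unit _))⟩⟩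
  · have h2 := two_ne_zero_of_odd_natCard hK
    obtain ⟨n, rfl⟩ : ∃ n, m = n + 3 := ⟨m - 3, by omega⟩
    obtain ⟨p, hpos, hirr, hprod⟩ := exists_factorization_finite K (n + 1)
    obtain ⟨f, g, hfg, hf, hg, hfg'⟩ := exists_mul_eq_X_pow_add_one K n
    have hr : ∏ j, ![f, g] j = X ^ 2 ^ (n + 3 - 1) + 1 := by simpa using hfg
    have hrpos (j) : 0 < (![f, g] j).natDegree := by fin_cases j <;> assumption
    have hrdvd (j) : ![f, g] j ∣ X ^ 2 ^ (n + 2) + 1 :=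
      (Finset.dvd_prod_of_mem _ (Finset.mem_univ j)).trans hr.dvd
    have hrirr (hq : Nat.card K % 8 = 3) (j) : Irreducible (![f, g] j) := by
      fin_cases j
      exacts [(hfg' hq).1, (hfg' hq).2]
    generalize ![f, g] = r at hr hrpos hrdvd hrirr
    obtain ⟨σ, ⟨φ⟩⟩ := hG.nonempty_algEquiv (by omega) h2 hprod hr
      (N := 4 * (n + 3) - 2) (by simp; omega)
    have hnontriv (q : K[X]) (hq : 0 < q.natDegree) : Nontrivial (AdjoinRoot q) :=
      AdjoinRoot.nontrivial q (natDegree_pos_iff_degree_pos.1 hq).ne'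
    have (i : _) := hnontriv _ (hpos i)
    have (j : _) := hnontriv _ (hrpos j)
    have : Module.Finite K (MonoidAlgebra K G) := .of_basis (MonoidAlgebra.basis _ K)
    have : Finite (MonoidAlgebra K G) := Module.finite_of_finite K
    have hle : 4 * (n + 3) ≤ numSimpleComponents (MonoidAlgebra K G) := by
      have := card_add_card_le_numSimpleComponents φ.toRingEquiv
      simp only [Nat.card_eq_fintype_card, Fintype.card_fin] at this
      omega
    refine ⟨hG.isSemisimpleRing (by omega) h2, hle, fun hq => ?_⟩
    have (i : _) : Fact (Irreducible (p i)) := ⟨hirr hq i⟩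
    have (j : _) : Fact (Irreducible (r j)) := ⟨hrirr hq j⟩
    have h0 (j) : AdjoinRoot.root (r j) ≠ 0 := AdjoinRoot.root_ne_zero_of_dvd (hrdvd j)
    have hsplit (j) : Nonempty (ℍ[AdjoinRoot (r j), AdjoinRoot.root (r j), AdjoinRoot.root (r j)]
        ≃ₐ[AdjoinRoot (r j)] Matrix (Fin 2) (Fin 2) (AdjoinRoot (r j))) := by
      have h2' : (2 : AdjoinRoot (r j)) ≠ 0 := by
        have := (map_ne_zero (algebraMap K (AdjoinRoot (r j)))).2 h2
        rwa [map_ofNat] at this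
      -- the root has order `2 ^ (n + 3)`, so its `2 ^ (n + 1)`-st power squares to `-1`
      refine nonempty_quaternion_algEquiv_matrix h2' (h0 j)
        (d := AdjoinRoot.root (r j) ^ 2 ^ (n + 1)) ?_
      rw [← pow_mul, ← pow_succ, AdjoinRoot.root_pow_eq_neg_one (hrdvd j)]
    refine ⟨hle.antisymm' ?_, fun i => AdjoinRoot (p (σ i)),
      fun i => inferInstanceAs (Field (AdjoinRoot _)),
      fun i => inferInstanceAs (Algebra K (AdjoinRoot _)), fun j => AdjoinRoot (r j),
      fun j => inferInstanceAs (Field (AdjoinRoot _)),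
      fun j => inferInstanceAs (Algebra K (AdjoinRoot _)), fun j => .root (r j),
      fun j => .root (r j), fun j => ⟨h0 j, h0 j⟩, ⟨φ⟩, hsplit⟩
    have (i : _) : IsSimpleRing (AdjoinRoot (p i)) := DivisionRing.isSimpleRing _
    have (j : _) : IsSimpleRing
        ℍ[AdjoinRoot (r j), AdjoinRoot.root (r j), AdjoinRoot.root (r j)] :=
      let ⟨ψ⟩ := hsplit j
      .of_ringEquiv ψ.symm.toRingEquiv inferInstance
    have := numSimpleComponents_le_card_add_card φ.toRingEquiv
    simp only [Nat.card_eq_fintype_card, Fintype.card_fin] at this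
    omega
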